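/- For a real number $c$, let $\Phi$ denote the conformal mapping of $\overline{\mathbb C}\setminus[c-2,c+2]$ onto $\overline{\mathbb C}\setminus\{|z|\le 1\}$ with $\Phi(\infty)=\infty$ and $\Phi'(\infty)>0$; explicitly, $\Phi(z)=\tfrac12\bigl(w+\sqrt{w^2-4}\bigr)$ with $w=z-c$ and the branch of the square root that behaves like $w$ at $\infty$. For a polynomial $P(z)=a\prod_{j=1}^{n}(z-\alpha_j)$ with $a\neq 0$, define the generalized Mahler measure $$M(P):=|a|\prod_{\alpha_j\notin[c-2,c+2]}|\Phi(\alpha_j)|.$$ **Proposition 2.8.** Let $c\ge 2$ be real. Let $(P_k)_{k\ge 0}$ be a sequence of polynomials with integer coefficients, of exact degrees $n_k\to\infty$ (for instance $n_k=k+1$), such that all complex zeros $\alpha_{1,k},\dots,\alpha_{n_k,k}$ of $P_k$ are simple and lie in $(0,\infty)$. If $\lim_{k\to\infty}M(P_k)^{1/n_k}=1$, then $$\liminf_{k\to\infty}\ \frac1{n_k}\sum_{j=1}^{n_k}\alpha_{j,k}\ \ge\ c\ \ge\ 2,$$ where the $\liminf$ is taken in $[-\infty,+\infty]$. -/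

import Mathlib

open Filter Topology Polynomial

namespace PolyZeros

/-- The segment `[c - 2, c + 2]` of the real line, as a subset of the complex plane. -/
def seg (c : ℝ) : Set ℂ := (fun x : ℝ => (x : ℂ)) '' Set.Icc (c - 2) (c + 2)

/-- `ℝ₊ = (0, ∞)`, as a subset of the complex plane. -/
def posReals : Set ℂ := (fun x : ℝ => (x : ℂ)) '' Set.Ioi 0

/-- The polynomials with integer coefficients, of exact degree `n`, all of whose complex zeros are
simple and lie in `E`. -/
def simpleIntPolys (n : ℕ) (E : Set ℂ) : Set ℤ[X] :=
  {P | P.degree = n ∧ (P.aroots ℂ).Nodup ∧ ∀ α ∈ P.aroots ℂ, α ∈ E}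

/-- The canonical conformal mapping of the complement of `[c - 2, c + 2]` in the Riemann sphere
onto the complement of the closed unit disk, with `∞ ↦ ∞` and positive derivative at `∞`:
`Φ(z) = (w + √(w² - 4)) / 2`, where `w = z - c` and the branch of the root that behaves like `w` at
`∞` is written as `w √(1 - 4 / w²)` with the principal root. The theorems below verify that it is
that mapping; its values on the segment itself play no role. -/
noncomputable def conformalMap (c : ℝ) (z : ℂ) : ℂ :=
  (z - c) * (1 + (1 - 4 / (z - c) ^ 2) ^ (1 / 2 : ℂ)) / 2

/-- The generalized Mahler measure of `P` with respect to `[c - 2, c + 2]`: the modulus of the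
leading coefficient times the product of `|Φ(α)|` over the zeros `α` (with multiplicity) outside
the segment. -/
noncomputable def mahler (c : ℝ) (P : ℤ[X]) : ℝ :=
  open Classical in
  |(P.leadingCoeff : ℝ)| *
    (((P.aroots ℂ).filter (fun α => α ∉ seg c)).map (fun α => ‖conformalMap c α‖)).prod

/-- The arithmetic mean of the complex zeros of `P`. (It is a real number whenever `P` has integer
coefficients, the zeros being invariant under conjugation; we record it as a real number.) -/
noncomputable def zeroMean (P : ℤ[X]) : ℝ := ((P.aroots ℂ).sum / P.natDegree).re

theorem mem_slitPlane_of_notMem_seg {c : ℝ} {z : ℂ} (hz : z ∉ seg c) :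
    z - c ≠ 0 ∧ 1 - 4 / (z - c) ^ 2 ∈ Complex.slitPlane := by
  have h0 : z - c ≠ 0 := by
    intro h
    exact hz ⟨c, ⟨by linarith, by linarith⟩, (sub_eq_zero.mp h).symm⟩
  refine ⟨h0, ?_⟩
  rw [Complex.mem_slitPlane_iff_not_le_zero]
  intro hle
  obtain ⟨hre, him⟩ := Complex.le_def.mp hle
  set w : ℂ := z - c with hw
  set q : ℂ := 4 / w ^ 2 with hq
  have hqim : q.im = 0 := by simpa using him
  have hqre : 1 ≤ q.re := by simpa using hre
  have hqr : q = (q.re : ℂ) := Complex.ext rfl (by simp [hqim])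
  have hqpos : 0 < q.re := by linarith
  have hqw : q * w ^ 2 = 4 := by rw [hq]; field_simp
  rw [hqr] at hqw
  have e1 := congrArg Complex.re hqw
  have e2 := congrArg Complex.im hqw
  simp [pow_two] at e1 e2
  have hprod : w.re * w.im = 0 := by
    rcases e2 with h | h
    · exact absurd h hqpos.ne'
    · linarith
  have hwim : w.im = 0 := by
    rcases mul_eq_zero.mp hprod with h | h
    · exfalso
      rw [h] at e1
      nlinarith [mul_self_nonneg w.im, mul_nonneg hqpos.le (mul_self_nonneg w.im)]
    · exact h
  rw [hwim] at e1
  have h4 : w.re * w.re ≤ 4 := by nlinarith [mul_self_nonneg w.re]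
  refine hz ⟨c + w.re, ⟨by nlinarith, by nlinarith⟩, ?_⟩
  have hwr : w = (w.re : ℂ) := Complex.ext rfl (by simp [hwim])
  have : z = c + w := by rw [hw]; ring
  rw [this]
  push_cast
  rw [← hwr]

/-- Off the segment, `Φ(z)` is the solution of `ζ + 1 / ζ = z - c` outside the unit disk. -/
theorem conformalMap_spec {c : ℝ} {z : ℂ} (hz : z ∉ seg c) :
    1 < ‖conformalMap c z‖ ∧ conformalMap c z + (conformalMap c z)⁻¹ = z - c := by
  obtain ⟨h0, hs⟩ := mem_slitPlane_of_notMem_seg hz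
  unfold conformalMap
  set w : ℂ := z - c with hw
  set s : ℂ := (1 - 4 / w ^ 2) ^ (1 / 2 : ℂ) with hsd
  have hs2 : s ^ 2 = 1 - 4 / w ^ 2 := by
    rw [hsd, ← Complex.cpow_nat_mul]; simp
  have hsre : 0 < s.re := by
    have hne := Complex.slitPlane_ne_zero hs
    have harg := Complex.arg_lt_pi_iff.mpr (by
      rcases hs with h | h
      · exact Or.inl h.le
      · exact Or.inr h)
    have harg' := Complex.neg_pi_lt_arg (1 - 4 / w ^ 2)
    rw [hsd, Complex.cpow_def_of_ne_zero hne, Complex.exp_re]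
    refine mul_pos (Real.exp_pos _) (Real.cos_pos_of_mem_Ioo ?_)
    have him : (Complex.log (1 - 4 / w ^ 2) * (1 / 2)).im = (1 - 4 / w ^ 2).arg / 2 := by
      rw [show (1 / 2 : ℂ) = ((1 / 2 : ℝ) : ℂ) by push_cast; rfl, Complex.im_mul_ofReal,
        Complex.log_im]
      ring
    rw [him]
    constructor <;> linarith
  have hprod : (w * (1 + s) / 2) * (w * (1 - s) / 2) = 1 := by
    have : (w * (1 + s) / 2) * (w * (1 - s) / 2) = w ^ 2 * (1 - s ^ 2) / 4 := by ring
    rw [this, hs2]; field_simp; ring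
  have hinv : (w * (1 + s) / 2)⁻¹ = w * (1 - s) / 2 := inv_eq_of_mul_eq_one_right hprod
  refine ⟨?_, by rw [hinv]; ring⟩
  have hlt : ‖w * (1 - s) / 2‖ < ‖w * (1 + s) / 2‖ := by
    have hl : ‖1 - s‖ < ‖1 + s‖ := by
      rw [Complex.norm_def, Complex.norm_def]
      apply Real.sqrt_lt_sqrt (Complex.normSq_nonneg _)
      simp only [Complex.normSq_apply, Complex.sub_re, Complex.add_re, Complex.one_re,
        Complex.sub_im, Complex.add_im, Complex.one_im]
      nlinarith
    rw [norm_div, norm_div, norm_mul, norm_mul]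
    have := norm_pos_iff.mpr h0
    gcongr
    simp
  have hn : ‖w * (1 + s) / 2‖ * ‖w * (1 - s) / 2‖ = 1 := by rw [← norm_mul, hprod, norm_one]
  by_contra hcon
  push Not at hcon
  nlinarith [norm_nonneg (w * (1 - s) / 2), norm_nonneg (w * (1 + s) / 2)]

/-- `Φ` is holomorphic off the segment. -/
theorem conformalMap_differentiableOn (c : ℝ) :
    DifferentiableOn ℂ (conformalMap c) (seg c)ᶜ := by
  intro z hz
  obtain ⟨h0, hs⟩ := mem_slitPlane_of_notMem_seg hz
  apply DifferentiableAt.differentiableWithinAt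
  have h1 : DifferentiableAt ℂ (fun z : ℂ => 1 - 4 / (z - c) ^ 2) z := by
    have : (z - c) ^ 2 ≠ 0 := pow_ne_zero 2 h0
    fun_prop (disch := assumption)
  have h2 : DifferentiableAt ℂ (fun z : ℂ => (1 - 4 / (z - c) ^ 2) ^ (1 / 2 : ℂ)) z :=
    h1.cpow_const hs
  unfold conformalMap
  fun_prop

/-- `Φ` maps the complement of the segment bijectively onto the complement of the closed unit
disk. -/
theorem conformalMap_bijOn (c : ℝ) :
    Set.BijOn (conformalMap c) (seg c)ᶜ {w : ℂ | 1 < ‖w‖} := by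
  refine ⟨fun z hz => (conformalMap_spec hz).1, fun z hz z' hz' h => ?_, fun ζ hζ => ?_⟩
  · have h1 := (conformalMap_spec hz).2
    have h2 := (conformalMap_spec hz').2
    rw [h, h2] at h1
    exact (sub_left_inj.mp h1).symm
  · have hζ1 : 1 < ‖ζ‖ := hζ
    have hζ0 : ζ ≠ 0 := by
      rintro rfl
      simp at hζ1
      linarith
    have hnot : (c : ℂ) + (ζ + ζ⁻¹) ∉ seg c := by
      rintro ⟨x, ⟨hx1, hx2⟩, hx⟩
      have hq : ζ ^ 2 - ((x - c : ℝ) : ℂ) * ζ + 1 = 0 := by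
        have hx' : ((x - c : ℝ) : ℂ) = ζ + ζ⁻¹ := by
          push_cast
          have hx2 : (x : ℂ) = c + (ζ + ζ⁻¹) := hx
          rw [hx2]; ring
        rw [hx']; field_simp; ring
      have hns : 1 < ζ.re * ζ.re + ζ.im * ζ.im := by
        rw [← Complex.normSq_apply, Complex.normSq_eq_norm_sq]
        nlinarith
      have e1 := congrArg Complex.re hq
      have e2 := congrArg Complex.im hq
      simp [pow_two] at e1 e2
      have e3 : ζ.im * (2 * ζ.re - (x - c)) = 0 := by linarith
      rcases mul_eq_zero.mp e3 with h | h
      · rw [h] at e1 hns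
        have hr1 : (ζ.re - 1) * (ζ.re - 1) = (x - c - 2) * ζ.re := by linarith
        have hr2 : (ζ.re + 1) * (ζ.re + 1) = (x - c + 2) * ζ.re := by linarith
        rcases le_total 0 ζ.re with hr | hr
        · have h5 : (x - c - 2) * ζ.re ≤ 0 := mul_nonpos_of_nonpos_of_nonneg (by linarith) hr
          have h6 : ζ.re - 1 = 0 := by
            rw [← mul_self_eq_zero]
            exact le_antisymm (by linarith) (mul_self_nonneg _)
          nlinarith
        · have h5 : (x - c + 2) * ζ.re ≤ 0 := mul_nonpos_of_nonneg_of_nonpos (by linarith) hr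
          have h6 : ζ.re + 1 = 0 := by
            rw [← mul_self_eq_zero]
            exact le_antisymm (by linarith) (mul_self_nonneg _)
          nlinarith
      · nlinarith
    refine ⟨c + (ζ + ζ⁻¹), hnot, ?_⟩
    obtain ⟨h1, h2⟩ := conformalMap_spec hnot
    set η := conformalMap c (c + (ζ + ζ⁻¹)) with hη
    have hη0 : η ≠ 0 := by
      intro h
      rw [h] at h1
      simp at h1
      linarith
    have h3 : (η - ζ) * (η * ζ - 1) = 0 := by
      have h2' : η + η⁻¹ = ζ + ζ⁻¹ := by rw [h2]; ring
      field_simp at h2'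
      linear_combination h2'
    rcases mul_eq_zero.mp h3 with h | h
    · exact sub_eq_zero.mp h
    · exfalso
      have h4 : ‖η‖ * ‖ζ‖ = 1 := by rw [← norm_mul, sub_eq_zero.mp h, norm_one]
      nlinarith

/-- `Φ(∞) = ∞`. -/
theorem conformalMap_tendsto (c : ℝ) :
    Tendsto (fun z => ‖conformalMap c z‖) (Bornology.cobounded ℂ) atTop := by
  have hlim : Tendsto (fun z : ℂ => ‖z‖ - (‖(c : ℂ)‖ + 1)) (Bornology.cobounded ℂ) atTop :=
    tendsto_atTop_add_const_right _ _ tendsto_norm_cobounded_atTop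
  refine tendsto_atTop_mono' _ ?_ hlim
  have hb : Bornology.IsBounded (seg c) :=
    (isCompact_Icc.image Complex.continuous_ofReal).isBounded
  filter_upwards [Bornology.isBounded_def.mp hb] with z hz
  obtain ⟨h1, h2⟩ := conformalMap_spec hz
  have h3 : ‖(conformalMap c z)⁻¹‖ ≤ 1 := by
    rw [norm_inv]; exact inv_le_one_of_one_le₀ h1.le
  have h4 : ‖z - c‖ ≤ ‖conformalMap c z‖ + ‖(conformalMap c z)⁻¹‖ := by
    rw [← h2]; exact norm_add_le _ _
  have h5 := norm_sub_norm_le z (c : ℂ)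
  linarith

/-- `Φ(z) / z → 1` as `z → ∞`, so the derivative of `Φ` at `∞` is positive. -/
theorem conformalMap_div_tendsto (c : ℝ) :
    Tendsto (fun z : ℂ => conformalMap c z / z) (Bornology.cobounded ℂ) (𝓝 1) := by
  have hinv : Tendsto (fun z : ℂ => z⁻¹) (Bornology.cobounded ℂ) (𝓝 0) :=
    tendsto_inv₀_cobounded
  have h1 : Tendsto (fun z : ℂ => 1 - (c : ℂ) * z⁻¹ - (conformalMap c z)⁻¹ * z⁻¹)
      (Bornology.cobounded ℂ) (𝓝 (1 - (c : ℂ) * 0 - 0 * 0)) := by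
    refine (tendsto_const_nhds.sub (hinv.const_mul _)).sub (Tendsto.mul ?_ hinv)
    rw [tendsto_zero_iff_norm_tendsto_zero]
    simp only [norm_inv]
    exact (conformalMap_tendsto c).inv_tendsto_atTop
  have h2 : (1 : ℂ) - (c : ℂ) * 0 - 0 * 0 = 1 := by ring
  rw [h2] at h1
  refine h1.congr' ?_
  have hb : Bornology.IsBounded (seg c ∪ {0}) :=
    (isCompact_Icc.image Complex.continuous_ofReal).isBounded.union Bornology.isBounded_singleton
  filter_upwards [Bornology.isBounded_def.mp hb] with z hz
  have hz1 : z ∉ seg c := fun h => hz (Or.inl h)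
  have hz0 : z ≠ 0 := fun h => hz (Or.inr h)
  have h3 : conformalMap c z = z - c - (conformalMap c z)⁻¹ :=
    eq_sub_of_add_eq (conformalMap_spec hz1).2
  have h4 : conformalMap c z / z = (z - c - (conformalMap c z)⁻¹) / z := by rw [← h3]
  rw [h4]
  field_simp

end PolyZeros

/-!
The zeros are written as `c + z + 1 / z` with `|z| ≥ 1`, so that `M(P)` is the modulus of the leading
coefficient times the product of the `|z|`. Since the zeros are simple, the discriminant is a nonzero
integer, and the Vandermonde determinant of the zeros is bounded below
(`one_le_leadingCoeff_pow_mul_norm_det_vandermonde`). Expanding that determinant in Chebyshev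
polynomials, which are at most `2 |z| ^ k`, bounds it above by `n! 2 ^ n (∏ |z|) ^ n`; the two bounds
are consistent when `M(P) ^ (1 / n) → 1`, with only `exp (o(n ^ 2))` to spare.

A mean of the zeros below `c` would destroy this consistency, because the Chebyshev polynomials can
be replaced by other monic polynomials whose size carries the additional factor `|1 + ρ / z| ^ m`
(`exists_monic_norm_eval_le`). On the unit circle `2 log |1 + ρ / z| ≤ ρ ^ 2 + ρ (z + 1 / z)`, so
the product of these factors over all zeros is about `exp (m n ρ (mean - c) / 2)`. Off the circle
the same inequality holds up to a multiple of `log |z|`, thanks to the positivity of the zeros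
(`two_mul_log_norm_one_add_mul_inv_le`), and `∑ log |z| ≤ log M(P) = o(n)`. The `m`
polynomials of degree below `m` cost a factor `(1 - ρ) ^ (-m ^ 2)`. With `m = ⌊ρ n⌋` this gives
`mean ≥ c - 5 ρ - o(1)` for each small `ρ` (`le_zeroMean`), hence the claim as `ρ → 0`.
-/

namespace PolyZeros

/-! ### Weighted analogues of the Chebyshev polynomials -/

/-- In the coordinate `y = z + 1 / z`, the Laurent polynomial
`z ^ k (1 + ρ / z) ^ j + z ^ (-k) (1 + ρ z) ^ j` with `j ≤ k` is a polynomial of degree `k`, monic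
unless `k = 0`. For `j = 0` these are the Chebyshev polynomials of the segment `[-2, 2]`. -/
theorem exists_polynomial_eval_add_inv (ρ : ℂ) (j k : ℕ) (hjk : j ≤ k) :
    ∃ p : ℂ[X], p.natDegree ≤ k ∧ p.coeff k = (if k = 0 then 2 else 1) ∧
      ∀ z : ℂ, z ≠ 0 → p.eval (z + z⁻¹) =
        z ^ k * (1 + ρ * z⁻¹) ^ j + z⁻¹ ^ k * (1 + ρ * z) ^ j := by
  induction j generalizing k with
  | zero =>
    clear hjk
    induction k using Nat.twoStepInduction with
    | zero => exact ⟨C 2, by simp, by simp, fun z _ => by simp; norm_num⟩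
    | one => exact ⟨X, by simp, by simp, fun z _ => by simp⟩
    | more k ih₀ ih₁ =>
      obtain ⟨p, hp, -, hpe⟩ := ih₀
      obtain ⟨q, hq, hqc, hqe⟩ := ih₁
      refine ⟨q * X - p, ?_, ?_, fun z hz => ?_⟩
      · refine (natDegree_sub_le _ _).trans (max_le ?_ (by omega))
        exact (natDegree_mul_le).trans (by simp; omega)
      · rw [coeff_sub, coeff_mul_X, hqc, coeff_eq_zero_of_natDegree_lt (by omega)]
        simp
      · rw [eval_sub, eval_mul, eval_X, hpe z hz, hqe z hz]
        have h : z * z⁻¹ = 1 := mul_inv_cancel₀ hz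
        simp only [pow_zero, mul_one]
        linear_combination (z ^ k + z⁻¹ ^ k) * h
  | succ j ih =>
    obtain ⟨k, rfl⟩ : ∃ i, k = i + 1 := ⟨k - 1, by omega⟩
    obtain ⟨p, hp, hpc, hpe⟩ := ih (k + 1) (by omega)
    obtain ⟨q, hq, -, hqe⟩ := ih k (by omega)
    refine ⟨p + C ρ * q, ?_, ?_, fun z hz => ?_⟩
    · refine (natDegree_add_le _ _).trans (max_le hp ?_)
      exact (natDegree_C_mul_le _ _).trans (by omega)
    · rw [coeff_add, coeff_C_mul, hpc, coeff_eq_zero_of_natDegree_lt (p := q) (by omega)]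
      simp
    · rw [eval_add, eval_mul, eval_C, hpe z hz, hqe z hz]
      have h : z * z⁻¹ = 1 := mul_inv_cancel₀ hz
      linear_combination (-ρ * z ^ k * (1 + ρ * z⁻¹) ^ j - ρ * z⁻¹ ^ k * (1 + ρ * z) ^ j) * h

theorem norm_one_add_mul_le {ρ : ℝ} (h1 : ρ ^ 2 ≤ 1) {z : ℂ} (hz : 1 ≤ ‖z‖) :
    ‖1 + ρ * z‖ ≤ ‖z‖ * ‖1 + ρ * z⁻¹‖ := by
  have hz0 : z ≠ 0 := norm_pos_iff.mp (by linarith)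
  rw [← norm_mul, mul_add, mul_one, mul_left_comm, mul_inv_cancel₀ hz0, mul_one]
  refine le_of_sq_le_sq ?_ (norm_nonneg _)
  have hz2 : 1 ≤ z.re * z.re + z.im * z.im := by
    rw [← Complex.normSq_apply, Complex.normSq_eq_norm_sq]
    nlinarith
  rw [← Complex.normSq_eq_norm_sq, ← Complex.normSq_eq_norm_sq, Complex.normSq_apply,
    Complex.normSq_apply]
  simp
  nlinarith [mul_nonneg (sub_nonneg.mpr h1) (sub_nonneg.mpr hz2)]

theorem one_sub_le_norm_one_add_mul_inv {ρ : ℝ} (h0 : 0 ≤ ρ) {z : ℂ} (hz : 1 ≤ ‖z‖) :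
    1 - ρ ≤ ‖1 + ρ * z⁻¹‖ := by
  have h1 : ‖(ρ : ℂ) * z⁻¹‖ ≤ ρ := by
    rw [norm_mul, norm_inv, Complex.norm_real, Real.norm_of_nonneg h0]
    exact mul_le_of_le_one_right h0 (inv_le_one_of_one_le₀ hz)
  have h2 := norm_sub_norm_le (1 : ℂ) (-(ρ * z⁻¹))
  rw [norm_one, norm_neg, sub_neg_eq_add] at h2
  linarith

/-- A monic polynomial of degree `k` whose size at `z + 1 / z` is at most that of the Chebyshev
polynomial, `2 |z| ^ k`, times `|1 + ρ / z| ^ m`. When `k < m` there is no room for that last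
factor, and a power of `(1 - ρ)⁻¹` is lost. -/
theorem exists_monic_norm_eval_le {ρ : ℝ} (h0 : 0 ≤ ρ) (h1 : ρ < 1) (m k : ℕ) :
    ∃ p : ℂ[X], p.natDegree = k ∧ p.Monic ∧ ∀ z : ℂ, 1 ≤ ‖z‖ →
      ‖p.eval (z + z⁻¹)‖ ≤ 2 * ‖z‖ ^ k * ‖1 + ρ * z⁻¹‖ ^ m * ((1 - ρ)⁻¹) ^ (m - k) := by
  have key : ∀ z : ℂ, 1 ≤ ‖z‖ →
      ‖1 + ρ * z⁻¹‖ ^ (min m k) ≤ ‖1 + ρ * z⁻¹‖ ^ m * ((1 - ρ)⁻¹) ^ (m - k) := by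
    intro z hz
    have hb := one_sub_le_norm_one_add_mul_inv h0 hz
    set b := ‖1 + ρ * z⁻¹‖
    have hm : m = min m k + (m - k) := by omega
    have hbK : 1 ≤ b * (1 - ρ)⁻¹ := by
      rw [← div_eq_mul_inv, le_div_iff₀ (by linarith)]
      linarith
    calc b ^ min m k ≤ b ^ min m k * (b * (1 - ρ)⁻¹) ^ (m - k) :=
          le_mul_of_one_le_right (by positivity) (one_le_pow₀ hbK)
      _ = b ^ (min m k + (m - k)) * ((1 - ρ)⁻¹) ^ (m - k) := by rw [mul_pow, pow_add]; ring
      _ = _ := by rw [← hm]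
  rcases Nat.eq_zero_or_pos k with rfl | hk
  · refine ⟨1, by simp, monic_one, fun z hz => ?_⟩
    have := key z hz
    simp only [Nat.min_zero, pow_zero] at this
    simp only [eval_one, norm_one, pow_zero, mul_one]
    rw [mul_assoc]
    linarith
  · obtain ⟨p, hp, hpc, hpe⟩ := exists_polynomial_eval_add_inv ρ (min m k) k (min_le_right _ _)
    rw [if_neg hk.ne'] at hpc
    refine ⟨p, ?_, monic_of_natDegree_le_of_coeff_eq_one k hp hpc, fun z hz => ?_⟩
    · exact le_antisymm hp (le_natDegree_of_ne_zero (by rw [hpc]; exact one_ne_zero))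
    · have hz0 : z ≠ 0 := norm_pos_iff.mp (by linarith)
      rw [hpe z hz0]
      set j := min m k with hj
      have hjk : j ≤ k := min_le_right _ _
      have hzk : ‖z⁻¹‖ ^ k * (‖z‖ * ‖1 + ρ * z⁻¹‖) ^ j ≤ ‖z‖ ^ k * ‖1 + ρ * z⁻¹‖ ^ j := by
        have e : ‖z⁻¹‖ ^ k * ‖z‖ ^ j ≤ ‖z‖ ^ k := by
          have e1 : ‖z⁻¹‖ ^ k ≤ 1 := pow_le_one₀ (norm_nonneg _)
            (by rw [norm_inv]; exact inv_le_one_of_one_le₀ hz)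
          calc _ ≤ 1 * ‖z‖ ^ j := by gcongr
            _ ≤ ‖z‖ ^ k := by rw [one_mul]; exact pow_le_pow_right₀ hz hjk
        rw [mul_pow, ← mul_assoc]
        gcongr
      calc _ ≤ ‖z‖ ^ k * ‖1 + ρ * z⁻¹‖ ^ j + ‖z⁻¹‖ ^ k * ‖1 + ρ * z‖ ^ j := by
            refine (norm_add_le _ _).trans_eq ?_
            simp only [norm_mul, norm_pow]
        _ ≤ ‖z‖ ^ k * ‖1 + ρ * z⁻¹‖ ^ j + ‖z⁻¹‖ ^ k * (‖z‖ * ‖1 + ρ * z⁻¹‖) ^ j := by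
            gcongr
            exact norm_one_add_mul_le (by nlinarith) hz
        _ ≤ 2 * ‖z‖ ^ k * ‖1 + ρ * z⁻¹‖ ^ j := by linarith
        _ ≤ 2 * ‖z‖ ^ k * (‖1 + ρ * z⁻¹‖ ^ m * ((1 - ρ)⁻¹) ^ (m - k)) := by
            gcongr
            exact key z hz
        _ = _ := by ring

/-! ### Bounding the Vandermonde determinant -/

theorem norm_det_le_factorial_mul {n : ℕ} (A : Matrix (Fin n) (Fin n) ℂ) (R K : Fin n → ℝ)
    (h : ∀ i k, ‖A i k‖ ≤ R i * K k) :
    ‖A.det‖ ≤ n.factorial * ((∏ i, R i) * ∏ k, K k) := by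
  rw [Matrix.det_apply]
  refine (norm_sum_le _ _).trans ?_
  have : ∀ σ ∈ (Finset.univ : Finset (Equiv.Perm (Fin n))),
      ‖Equiv.Perm.sign σ • ∏ i, A (σ i) i‖ ≤ (∏ i, R i) * ∏ k, K k := by
    intro σ _
    have e : ‖Equiv.Perm.sign σ • ∏ i, A (σ i) i‖ = ∏ i, ‖A (σ i) i‖ := by
      rcases Int.units_eq_one_or (Equiv.Perm.sign σ) with hs | hs <;> simp [hs, norm_prod]
    rw [e, ← Equiv.prod_comp σ R, ← Finset.prod_mul_distrib]
    exact Finset.prod_le_prod (fun _ _ => norm_nonneg _) fun i _ => h _ _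
  refine (Finset.sum_le_card_nsmul _ _ _ this).trans_eq ?_
  simp [Fintype.card_perm]

/-- The Vandermonde determinant does not change when its columns are replaced by monic
polynomials; for those of `exists_monic_norm_eval_le` the Leibniz expansion yields this bound. -/
theorem norm_det_vandermonde_le {ρ : ℝ} (h0 : 0 ≤ ρ) (h1 : ρ < 1) (m n : ℕ) (z : Fin n → ℂ)
    (hz : ∀ i, 1 ≤ ‖z i‖) :
    ‖(Matrix.vandermonde fun i => z i + (z i)⁻¹).det‖ ≤
      n.factorial * ((∏ i, 2 * ‖z i‖ ^ n * ‖1 + ρ * (z i)⁻¹‖ ^ m) * ((1 - ρ)⁻¹) ^ (m * m)) := by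
  choose p hpd hpm hpe using fun k : ℕ => exists_monic_norm_eval_le h0 h1 m k
  rw [Matrix.det_eval_matrixOfPolynomials_eq_det_vandermonde _ (fun k : Fin n => p k)
    (fun k => hpd k) (fun k => hpm k)]
  have hK : 1 ≤ (1 - ρ)⁻¹ := (one_le_inv₀ (by linarith)).mpr (by linarith)
  refine (norm_det_le_factorial_mul _ (fun i => 2 * ‖z i‖ ^ n * ‖1 + ρ * (z i)⁻¹‖ ^ m)
    (fun k => ((1 - ρ)⁻¹) ^ (m - (k : ℕ))) fun i k => ?_).trans ?_
  · simp only [Matrix.of_apply]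
    refine (hpe k (z i) (hz i)).trans ?_
    gcongr
    · exact hz i
    · exact k.2.le
  · rw [Finset.prod_pow_eq_pow_sum]
    gcongr
    · rw [Fin.sum_univ_eq_sum_range (fun k => m - k)]
      calc ∑ k ∈ Finset.range n, (m - k) ≤ ∑ k ∈ Finset.range n, if k < m then m else 0 := by
            gcongr with k
            split_ifs <;> omega
        _ ≤ m * m := by
            rw [← Finset.sum_filter, Finset.sum_const, smul_eq_mul]
            gcongr
            calc _ ≤ (Finset.range m).card := Finset.card_le_card fun k hk => by
                  simpa using (Finset.mem_filter.mp hk).2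
              _ = m := Finset.card_range m

/-! ### Integrality of the discriminant -/

theorem prod_norm_sub_eq_norm_det_vandermonde_sq {n : ℕ} (v : Fin n → ℂ) :
    ∏ i, ∏ j ∈ Finset.univ.erase i, ‖v i - v j‖ = ‖(Matrix.vandermonde v).det‖ ^ 2 := by
  have hsplit : ∀ i : Fin n, ∏ j ∈ Finset.univ.erase i, ‖v i - v j‖ =
      (∏ j ∈ Finset.Ioi i, ‖v i - v j‖) * ∏ j ∈ Finset.Iio i, ‖v i - v j‖ := by
    intro i
    rw [← Finset.prod_union]
    · congr 1
      ext j
      simp only [Finset.mem_erase, Finset.mem_univ, and_true, Finset.mem_union, Finset.mem_Ioi,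
        Finset.mem_Iio]
      exact ⟨fun h => (lt_or_gt_of_ne h).symm, fun h => h.elim (fun h => h.ne') fun h => h.ne⟩
    · rw [Finset.disjoint_left]
      intro j h1 h2
      exact lt_asymm (Finset.mem_Ioi.mp h1) (Finset.mem_Iio.mp h2)
  have hswap : ∏ i, ∏ j ∈ Finset.Iio i, ‖v i - v j‖ = ∏ i, ∏ j ∈ Finset.Ioi i, ‖v i - v j‖ := by
    rw [Finset.prod_comm' (t' := Finset.univ) (s' := fun j => Finset.Ioi j) (by simp)]
    simp only [norm_sub_rev]
  rw [Finset.prod_congr rfl fun i _ => hsplit i, Finset.prod_mul_distrib, hswap,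
    Matrix.det_vandermonde, norm_prod, sq]
  simp only [norm_prod, norm_sub_rev]

/-- The resultant of `P` and `P'` is a nonzero integer when the zeros of `P` are simple. -/
theorem one_le_leadingCoeff_pow_mul_norm_det_vandermonde {n : ℕ} {P : ℤ[X]} (hP : P ≠ 0)
    (v : Fin n → ℂ) (hv : Function.Injective v)
    (hroots : P.aroots ℂ = Finset.univ.val.map v) :
    1 ≤ |(P.leadingCoeff : ℝ)| ^ n * ‖(Matrix.vandermonde v).det‖ := by
  set Q : ℂ[X] := P.map (algebraMap ℤ ℂ) with hQ
  have hinj : Function.Injective (algebraMap ℤ ℂ) := Int.cast_injective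
  have hsplit : Q.Splits := IsAlgClosed.splits Q
  have hQroots : Q.roots = Finset.univ.val.map v := hroots
  have hn : Q.natDegree = n := by
    rw [hsplit.natDegree_eq_card_roots, hQroots]
    simp
  have hQl : Q.leadingCoeff = (P.leadingCoeff : ℂ) := leadingCoeff_map_of_injective hinj P
  have hQprod : Q = C Q.leadingCoeff * ∏ i, (X - C (v i)) := by
    conv_lhs => rw [hsplit.eq_prod_roots, hQroots, Multiset.map_map]
    rfl
  have hder : ∀ i, (derivative Q).eval (v i) =
      Q.leadingCoeff * ∏ j ∈ Finset.univ.erase i, (v i - v j) := by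
    intro i
    conv_lhs => rw [hQprod]
    rw [derivative_C_mul, eval_mul, eval_C, derivative_prod_finset, eval_finsetSum,
      Finset.sum_eq_single i]
    · simp [eval_prod]
    · intro j _ hj
      have : ∏ k ∈ Finset.univ.erase j, (v i - v k) = 0 :=
        Finset.prod_eq_zero (Finset.mem_erase.mpr ⟨hj.symm, Finset.mem_univ i⟩) (sub_self _)
      simp [eval_prod, this]
    · simp
  have hres : ((P.resultant (derivative P) n n : ℤ) : ℂ) =
      Q.leadingCoeff ^ n * ∏ i, (derivative Q).eval (v i) := by
    have h := resultant_eq_prod_eval Q (derivative Q) n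
      ((natDegree_derivative_le Q).trans (by omega)) hsplit
    rw [hn, hQ, derivative_map, resultant_map_map, ← hQ, hQroots, Multiset.map_map] at h
    rw [derivative_map]
    exact h
  have hnorm : ‖((P.resultant (derivative P) n n : ℤ) : ℂ)‖ =
      (|(P.leadingCoeff : ℝ)| ^ n * ‖(Matrix.vandermonde v).det‖) ^ 2 := by
    rw [hres, mul_pow, ← prod_norm_sub_eq_norm_det_vandermonde_sq]
    simp only [hder, norm_mul, norm_pow, norm_prod, Finset.prod_mul_distrib, Finset.prod_const,
      Finset.card_univ, Fintype.card_fin, hQl, Complex.norm_intCast]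
    ring
  have hpos : 0 < |(P.leadingCoeff : ℝ)| ^ n * ‖(Matrix.vandermonde v).det‖ := by
    have h1 : (P.leadingCoeff : ℝ) ≠ 0 := Int.cast_ne_zero.mpr (leadingCoeff_ne_zero.mpr hP)
    have h2 := norm_pos_iff.mpr (Matrix.det_vandermonde_ne_zero_iff.mpr hv)
    positivity
  have hne : P.resultant (derivative P) n n ≠ 0 := by
    intro h
    rw [h, Int.cast_zero, norm_zero] at hnorm
    exact (pow_pos hpos 2).ne hnorm
  have h1 : (1 : ℝ) ≤ ‖((P.resultant (derivative P) n n : ℤ) : ℂ)‖ := by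
    rw [Complex.norm_intCast]
    exact_mod_cast Int.one_le_abs hne
  rw [hnorm] at h1
  exact (one_le_sq_iff₀ hpos.le).mp h1

/-! ### The exterior coordinate of a zero -/

open Classical in
/-- Every `α` has the form `c + z + 1 / z` with `|z| = |Φ(α)|` off the segment `[c - 2, c + 2]` and
`|z| = 1` on it. -/
theorem exists_exterior_coordinate (c : ℝ) (α : ℂ) :
    ∃ z : ℂ, ‖z‖ = (if α ∉ seg c then ‖conformalMap c α‖ else 1) ∧ 1 ≤ ‖z‖ ∧
      z + z⁻¹ = α - c := by
  by_cases h : α ∈ seg c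
  · obtain ⟨x, ⟨hx1, hx2⟩, rfl⟩ := h
    have hsq : 0 ≤ 1 - ((x - c) / 2) ^ 2 := by nlinarith
    set s := √(1 - ((x - c) / 2) ^ 2) with hs
    have hs2 : s ^ 2 = 1 - ((x - c) / 2) ^ 2 := Real.sq_sqrt hsq
    have hn : ‖(⟨(x - c) / 2, s⟩ : ℂ)‖ = 1 := by
      rw [Complex.norm_def, Complex.normSq_mk, Real.sqrt_eq_one]
      linear_combination hs2
    refine ⟨⟨(x - c) / 2, s⟩, ?_, hn.ge, ?_⟩
    · rw [hn, if_neg]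
      exact not_not.mpr ⟨x, ⟨hx1, hx2⟩, rfl⟩
    · rw [Complex.inv_eq_conj hn]
      apply Complex.ext <;> simp
  · obtain ⟨h1, h2⟩ := conformalMap_spec h
    exact ⟨conformalMap c α, (if_pos h).symm, h1.le, h2⟩

/-- The concavity of the logarithm turns the factor `|1 + ρ / z|` into the coordinate
`y = z + 1 / z` itself, up to `ρ ^ 2` and a multiple of `log |z|`. The bound `-c < y`, that is the
positivity of the zero `c + y`, enters here. -/
theorem two_mul_log_norm_one_add_mul_inv_le {c ρ y : ℝ} (hc0 : 0 ≤ c) (h0 : 0 ≤ ρ) (h1 : ρ < 1)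
    {z : ℂ}
    (hz : 1 ≤ ‖z‖) (hy : z + z⁻¹ = y) (hc : -c < y) :
    2 * Real.log ‖1 + ρ * z⁻¹‖ ≤ ρ ^ 2 + ρ * y + 2 * c * ρ * Real.log ‖z‖ := by
  have hb := one_sub_le_norm_one_add_mul_inv h0 hz
  have hr0 : 0 < ‖z‖ := by linarith
  set r := ‖z‖ with hr
  have hinvre : (z⁻¹).re = z.re / r ^ 2 := by rw [Complex.inv_re, Complex.normSq_eq_norm_sq]
  have hyre : z.re + z.re / r ^ 2 = y := by
    have := congrArg Complex.re hy
    simpa [hinvre] using this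
  have hr2 : 1 ≤ r ^ 2 := one_le_pow₀ hz
  have hnsq : ‖1 + ρ * z⁻¹‖ ^ 2 = 1 + 2 * ρ * (z.re / r ^ 2) + ρ ^ 2 / r ^ 2 := by
    have e : Complex.normSq z⁻¹ = 1 / r ^ 2 := by
      rw [Complex.normSq_eq_norm_sq, norm_inv, inv_pow, one_div]
    rw [Complex.normSq_apply] at e
    rw [← Complex.normSq_eq_norm_sq, Complex.normSq_apply, ← hinvre]
    simp only [Complex.add_re, Complex.add_im, Complex.one_re, Complex.one_im, Complex.re_ofReal_mul,
      Complex.im_ofReal_mul]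
    linear_combination ρ ^ 2 * e
  have hlog : 2 * Real.log ‖1 + ρ * z⁻¹‖ ≤ 2 * ρ * (z.re / r ^ 2) + ρ ^ 2 := by
    have e := Real.log_le_sub_one_of_pos (x := ‖1 + ρ * z⁻¹‖ ^ 2) (pow_pos (by linarith) 2)
    rw [Real.log_pow, hnsq] at e
    have e2 : ρ ^ 2 / r ^ 2 ≤ ρ ^ 2 := div_le_self (sq_nonneg _) hr2
    push_cast at e
    linarith
  have hlogr : 1 - r⁻¹ ≤ Real.log r := Real.one_sub_inv_le_log_of_pos hr0
  have hlogr0 : 0 ≤ Real.log r := Real.log_nonneg hz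
  -- It remains to bound `Re (1 / z) - Re z`, which is positive only on the left half-plane.
  have hmain : 0 ≤ z.re - z.re / r ^ 2 + 2 * c * Real.log r := by
    have hu0 : 0 < r⁻¹ := inv_pos.mpr hr0
    have hu1 : r⁻¹ ≤ 1 := inv_le_one_of_one_le₀ hz
    have e : z.re / r ^ 2 = z.re * r⁻¹ ^ 2 := by rw [inv_pow, div_eq_mul_inv]
    rw [e] at hyre ⊢
    set u := r⁻¹
    have hu2 : 0 ≤ 1 - u ^ 2 := by nlinarith
    have hu3 : 1 - u ^ 2 ≤ 2 * Real.log r := by nlinarith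
    rcases le_total 0 z.re with hre | hre
    · have := mul_nonneg hre hu2
      have := mul_nonneg hc0 hlogr0
      nlinarith
    · have hcre : -z.re ≤ c := by nlinarith [mul_nonneg (neg_nonneg.mpr hre) (sq_nonneg u)]
      have := mul_le_mul hcre hu3 hu2 (by linarith)
      nlinarith
  nlinarith [mul_nonneg h0 hmain]

/-! ### The mean of the zeros of a single polynomial -/

/-- Simple zeros, listed as a vector, together with their exterior coordinates. -/
theorem exists_enumeration_of_mem_simpleIntPolys {c : ℝ} {n : ℕ} {P : ℤ[X]}
    (hP : P ∈ simpleIntPolys n posReals) :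
    ∃ (v : Fin n → ℝ) (z : Fin n → ℂ), Function.Injective v ∧ (∀ i, 0 < v i) ∧
      P.aroots ℂ = Finset.univ.val.map (fun i => (v i : ℂ)) ∧
      (∀ i, 1 ≤ ‖z i‖) ∧ (∀ i, z i + (z i)⁻¹ = ((v i - c : ℝ) : ℂ)) ∧
      mahler c P = |(P.leadingCoeff : ℝ)| * ∏ i, ‖z i‖ := by
  classical
  obtain ⟨hdeg, hnodup, hE⟩ := hP
  have hcard : Multiset.card (P.aroots ℂ) = n := by
    have hs := (IsAlgClosed.splits (P.map (algebraMap ℤ ℂ))).natDegree_eq_card_roots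
    rw [natDegree_map_eq_of_injective (Int.cast_injective : Function.Injective (algebraMap ℤ ℂ)),
      natDegree_eq_of_degree_eq_some hdeg] at hs
    exact hs.symm
  obtain ⟨w, hw⟩ : ∃ w : Fin n → ℂ, P.aroots ℂ = Finset.univ.val.map w := by
    subst hcard
    have hlen : (P.aroots ℂ).toList.length = Multiset.card (P.aroots ℂ) := Multiset.length_toList _
    refine ⟨fun i => (P.aroots ℂ).toList.get (i.cast hlen.symm), ?_⟩
    rw [Fin.univ_val_map]
    conv_lhs => rw [← Multiset.coe_toList (P.aroots ℂ)]
    congr 1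
    apply List.ext_get <;> simp
  have hmem : ∀ i, w i ∈ P.aroots ℂ := fun i => by
    rw [hw]
    exact Multiset.mem_map_of_mem w (Finset.mem_univ_val i)
  choose v hv0 hv using fun i => hE (w i) (hmem i)
  obtain rfl : w = fun i => (v i : ℂ) := funext fun i => (hv i).symm
  choose z hz hz1 hzv using fun i => exists_exterior_coordinate c (v i : ℂ)
  refine ⟨v, z, ?_, hv0, hw, hz1, fun i => by rw [hzv]; push_cast; rfl, ?_⟩
  · intro i j hij
    rw [hw, Multiset.nodup_map_iff_inj_on Finset.univ.nodup] at hnodup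
    exact hnodup i (Finset.mem_univ_val i) j (Finset.mem_univ_val j) (by simp [hij])
  · have hprod : ∏ i, ‖z i‖ = ∏ i with (v i : ℂ) ∉ seg c, ‖conformalMap c (v i)‖ := by
      rw [Finset.prod_filter]
      refine Finset.prod_congr rfl fun i _ => (hz i).trans ?_
      congr
    rw [hprod]
    unfold mahler
    rw [hw, Multiset.filter_map, Multiset.map_map]
    simp only [Finset.prod, Finset.filter_val, Function.comp_def]

/-- The logarithm of `1 ≤ |disc P|`, with the Vandermonde determinant bounded by means of the
polynomials of `exists_monic_norm_eval_le`. The term in `zeroMean P - c` is what these polynomials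
gain over the Chebyshev polynomials; `m ^ 2 log (1 - ρ)⁻¹` is what they lose. -/
theorem zero_le_log_mahler_add {c ρ : ℝ} (hc : 0 ≤ c) (h0 : 0 ≤ ρ) (h1 : ρ < 1) {n : ℕ}
    (hn : 0 < n) {P : ℤ[X]} (hP : P ∈ simpleIntPolys n posReals) (m : ℕ) :
    1 ≤ mahler c P ∧
    0 ≤ n * Real.log (mahler c P) + Real.log n.factorial + n * Real.log 2 +
      m * (n * ρ ^ 2 + n * ρ * (zeroMean P - c) + 2 * c * ρ * Real.log (mahler c P)) / 2 +
      m * m * Real.log (1 - ρ)⁻¹ := by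
  obtain ⟨v, z, hv, hv0, hroots, hz1, hzv, hM⟩ :=
    exists_enumeration_of_mem_simpleIntPolys (c := c) hP
  have hP0 : P ≠ 0 := by
    rintro rfl
    simpa using hP.1
  have ha : 1 ≤ |(P.leadingCoeff : ℝ)| := by
    exact_mod_cast Int.one_le_abs (leadingCoeff_ne_zero.mpr hP0)
  have hz0 : ∀ i, 0 < ‖z i‖ := fun i => lt_of_lt_of_le one_pos (hz1 i)
  have hb0 : ∀ i, 0 < ‖1 + ρ * (z i)⁻¹‖ := fun i =>
    lt_of_lt_of_le (by linarith) (one_sub_le_norm_one_add_mul_inv h0 (hz1 i))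
  have hM1 : 1 ≤ mahler c P := by
    rw [hM]
    exact one_le_mul_of_one_le_of_one_le ha
      (Finset.prod_induction _ (fun x => 1 ≤ x) (fun _ _ => one_le_mul_of_one_le_of_one_le)
        le_rfl fun i _ => hz1 i)
  refine ⟨hM1, ?_⟩
  set L := Real.log (mahler c P) with hL
  have hLsum : L = Real.log |(P.leadingCoeff : ℝ)| + ∑ i, Real.log ‖z i‖ := by
    rw [hL, hM, Real.log_mul (by positivity) (Finset.prod_pos fun i _ => hz0 i).ne',
      Real.log_prod fun i _ => (hz0 i).ne']
  have hLz : ∑ i, Real.log ‖z i‖ ≤ L := by linarith [Real.log_nonneg ha]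
  have hdisc := one_le_leadingCoeff_pow_mul_norm_det_vandermonde hP0 (fun i => (v i : ℂ))
    (Complex.ofReal_injective.comp hv) hroots
  have hvan : (Matrix.vandermonde fun i => (v i : ℂ)).det =
      (Matrix.vandermonde fun i => z i + (z i)⁻¹).det := by
    rw [← Matrix.det_vandermonde_sub (fun i => (v i : ℂ)) (c : ℂ)]
    congr 2
    funext i
    rw [hzv]
    push_cast
    rfl
  rw [hvan] at hdisc
  have hle := hdisc.trans (mul_le_mul_of_nonneg_left
    (norm_det_vandermonde_le h0 h1 m n z hz1) (by positivity))
  have hlog := Real.log_nonneg hle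
  have hKpos : 0 < (1 - ρ)⁻¹ := inv_pos.mpr (by linarith)
  have hRpos : ∀ i, 0 < 2 * ‖z i‖ ^ n * ‖1 + ρ * (z i)⁻¹‖ ^ m := fun i => by
    have := hz0 i
    have := hb0 i
    positivity
  have hprodpos := Finset.prod_pos fun i (_ : i ∈ Finset.univ) => hRpos i
  have hfac : (0 : ℝ) < n.factorial := by exact_mod_cast n.factorial_pos
  have hrow : ∀ i, Real.log (2 * ‖z i‖ ^ n * ‖1 + ρ * (z i)⁻¹‖ ^ m) =
      Real.log 2 + n * Real.log ‖z i‖ + m * Real.log ‖1 + ρ * (z i)⁻¹‖ := fun i => by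
    have := hz0 i
    have := hb0 i
    rw [Real.log_mul (by positivity) (by positivity), Real.log_mul (by positivity) (by positivity),
      Real.log_pow, Real.log_pow]
  rw [Real.log_mul (by positivity) (by positivity), Real.log_mul (by positivity) (by positivity),
    Real.log_mul (by positivity) (by positivity), Real.log_pow, Real.log_pow,
    Real.log_prod fun i _ => (hRpos i).ne', Finset.sum_congr rfl fun i _ => hrow i,
    Finset.sum_add_distrib, Finset.sum_add_distrib, Finset.sum_const, Finset.card_univ,
    Fintype.card_fin, nsmul_eq_mul, ← Finset.mul_sum, ← Finset.mul_sum] at hlog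
  have hmean : ∑ i, (v i - c) = n * (zeroMean P - c) := by
    have e : zeroMean P = (∑ i, v i) / n := by
      unfold zeroMean
      rw [natDegree_eq_of_degree_eq_some hP.1, hroots]
      have : (Finset.univ.val.map (fun i => (v i : ℂ))).sum = ((∑ i, v i : ℝ) : ℂ) := by
        push_cast
        rfl
      rw [this, ← Complex.ofReal_natCast, ← Complex.ofReal_div, Complex.ofReal_re]
    rw [e, Finset.sum_sub_distrib]
    simp
    field_simp
  have hS : 2 * ∑ i, Real.log ‖1 + ρ * (z i)⁻¹‖ ≤
      n * ρ ^ 2 + n * ρ * (zeroMean P - c) + 2 * c * ρ * L := by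
    calc 2 * ∑ i, Real.log ‖1 + ρ * (z i)⁻¹‖
        ≤ ∑ i, (ρ ^ 2 + ρ * (v i - c) + 2 * c * ρ * Real.log ‖z i‖) := by
          rw [Finset.mul_sum]
          exact Finset.sum_le_sum fun i _ =>
            two_mul_log_norm_one_add_mul_inv_le hc h0 h1 (hz1 i) (hzv i) (by linarith [hv0 i])
      _ = n * ρ ^ 2 + ρ * (n * (zeroMean P - c)) + 2 * c * ρ * ∑ i, Real.log ‖z i‖ := by
          rw [Finset.sum_add_distrib, Finset.sum_add_distrib, ← Finset.mul_sum, ← Finset.mul_sum,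
            hmean]
          simp
      _ ≤ _ := by
          have : 2 * c * ρ * ∑ i, Real.log ‖z i‖ ≤ 2 * c * ρ * L := by gcongr
          linarith
  have hm : (m : ℝ) * ∑ i, Real.log ‖1 + ρ * (z i)⁻¹‖ ≤
      m * (n * ρ ^ 2 + n * ρ * (zeroMean P - c) + 2 * c * ρ * L) / 2 := by
    have := mul_le_mul_of_nonneg_left hS (Nat.cast_nonneg (α := ℝ) m)
    linarith
  have hLn : (n : ℝ) * Real.log |(P.leadingCoeff : ℝ)| + n * ∑ i, Real.log ‖z i‖ = n * L := by
    rw [hLsum]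
    ring
  push_cast at hlog
  linarith

/-- The choice `m = ⌊ρ n⌋` makes both losses in `zero_le_log_mahler_add` of order `ρ`. -/
theorem le_zeroMean {c ρ : ℝ} (hc : 0 ≤ c) (h0 : 0 < ρ) (h1 : ρ ≤ 1 / 2) {n : ℕ}
    (hn : 2 / ρ ≤ n) {P : ℤ[X]} (hP : P ∈ simpleIntPolys n posReals) :
    c - 5 * ρ - (2 * c + 4 / ρ ^ 2) * (Real.log (mahler c P) / n)
      - 4 / ρ ^ 2 * ((Real.log n + Real.log 2) / n) ≤ zeroMean P := by
  have hnR : (0 : ℝ) < n := lt_of_lt_of_le (by positivity) hn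
  have hn0 : 0 < n := by exact_mod_cast hnR
  have hρn : 2 ≤ ρ * n := by rwa [div_le_iff₀' h0] at hn
  set m := ⌊ρ * n⌋₊ with hm
  have hm1 : (m : ℝ) ≤ ρ * n := Nat.floor_le (by positivity)
  have hm2 : ρ * n / 2 ≤ m := by
    have := Nat.lt_floor_add_one (ρ * n)
    rw [← hm] at this
    linarith
  have hm0 : (0 : ℝ) < m := by linarith
  obtain ⟨hM1, hmain⟩ := zero_le_log_mahler_add hc h0.le (by linarith : ρ < 1) hn0 hP m
  set L := Real.log (mahler c P)
  set x := zeroMean P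
  have hL0 : 0 ≤ L := Real.log_nonneg hM1
  have hfac : Real.log n.factorial ≤ n * Real.log n := by
    rw [← Real.log_pow]
    apply Real.log_le_log (by exact_mod_cast n.factorial_pos)
    exact_mod_cast n.factorial_le_pow
  have hlam : Real.log (1 - ρ)⁻¹ ≤ 2 * ρ := by
    have hpos : 0 < 1 - ρ := by linarith
    have := Real.log_le_sub_one_of_pos (inv_pos.mpr hpos)
    have e : (1 - ρ)⁻¹ - 1 ≤ 2 * ρ := by
      rw [sub_le_iff_le_add, inv_le_iff_one_le_mul₀ hpos]
      nlinarith
    linarith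
  have hlam0 : 0 ≤ Real.log (1 - ρ)⁻¹ :=
    Real.log_nonneg ((one_le_inv₀ (by linarith)).mpr (by linarith))
  have hloss : (m : ℝ) * m * Real.log (1 - ρ)⁻¹ ≤ m * (ρ * n) * (2 * ρ) := by gcongr
  set T := L + (Real.log n + Real.log 2) with hT
  have hT0 : 0 ≤ T := by
    have := Real.log_nonneg (show (1 : ℝ) ≤ n by exact_mod_cast hn0)
    have := Real.log_nonneg (show (1 : ℝ) ≤ 2 by norm_num)
    positivity
  -- `m ≥ ρ n / 2` lets every term carry the factor `m`, which is then cancelled.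
  have hT1 : n * T ≤ m * (2 * T / ρ) := by
    calc n * T = ρ * n / 2 * (2 * T / ρ) := by field_simp
      _ ≤ _ := by gcongr
  have hfin : 0 ≤ m * (2 * T / ρ + (n * ρ ^ 2 + n * ρ * (x - c) + 2 * c * ρ * L) / 2
      + 2 * ρ ^ 2 * n) := by
    linarith
  have hfin2 := nonneg_of_mul_nonneg_right hfin hm0
  have hdiv : 0 ≤ (2 * T / ρ + (n * ρ ^ 2 + n * ρ * (x - c) + 2 * c * ρ * L) / 2
      + 2 * ρ ^ 2 * n) * (2 / (n * ρ)) := by positivity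
  have e : (2 * T / ρ + (n * ρ ^ 2 + n * ρ * (x - c) + 2 * c * ρ * L) / 2
      + 2 * ρ ^ 2 * n) * (2 / (n * ρ)) =
      x - (c - 5 * ρ - (2 * c + 4 / ρ ^ 2) * (L / n)
        - 4 / ρ ^ 2 * ((Real.log n + Real.log 2) / n)) := by
    rw [hT]
    field_simp
    ring
  rw [e] at hdiv
  linarith

end PolyZeros

/-! ### Passage to the limit -/

theorem proposition2p8 (c : ℝ) (hc : 2 ≤ c) (d : ℕ → ℕ) (hd : Tendsto d atTop atTop)
    (P : ℕ → ℤ[X]) (hP : ∀ k, P k ∈ PolyZeros.simpleIntPolys (d k) PolyZeros.posReals)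
    (hM : Tendsto (fun k => (PolyZeros.mahler c (P k)) ^ (1 / (d k : ℝ))) atTop (𝓝 1)) :
    (c : EReal) ≤ liminf (fun k => (PolyZeros.zeroMean (P k) : EReal)) atTop ∧
      (2 : EReal) ≤ liminf (fun k => (PolyZeros.zeroMean (P k) : EReal)) atTop := by
  have hdR : Tendsto (fun k => (d k : ℝ)) atTop atTop := tendsto_natCast_atTop_atTop.comp hd
  have hL : Tendsto (fun k => Real.log (PolyZeros.mahler c (P k)) / d k) atTop (𝓝 0) := by
    have h := hM.log one_ne_zero
    rw [Real.log_one] at h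
    refine h.congr' ?_
    filter_upwards [hd.eventually_gt_atTop 0] with k hk
    have hpos := (PolyZeros.zero_le_log_mahler_add (by linarith : (0 : ℝ) ≤ c) le_rfl one_pos hk
      (hP k) 0).1
    rw [Real.log_rpow (by linarith)]
    ring
  have hlog : Tendsto (fun k => (Real.log (d k) + Real.log 2) / d k) atTop (𝓝 0) := by
    have h1 : Tendsto (fun x : ℝ => Real.log x / x) atTop (𝓝 0) :=
      Real.isLittleO_log_id_atTop.tendsto_div_nhds_zero
    have h2 : Tendsto (fun x : ℝ => Real.log 2 / x) atTop (𝓝 0) :=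
      tendsto_const_nhds.div_atTop tendsto_id
    have h3 := (h1.add h2).comp hdR
    rw [add_zero] at h3
    refine h3.congr fun k => ?_
    simp [add_div]
  have hlim : (c : EReal) ≤ liminf (fun k => (PolyZeros.zeroMean (P k) : EReal)) atTop := by
    refine EReal.ge_of_forall_gt_iff_ge.mp fun a ha => ?_
    have hac : a < c := by exact_mod_cast ha
    obtain ⟨ρ, hρ0, hρ1, hρa⟩ : ∃ ρ : ℝ, 0 < ρ ∧ ρ ≤ 1 / 2 ∧ a < c - 5 * ρ :=
      ⟨min (1 / 2) ((c - a) / 10), lt_min (by norm_num) (by linarith), min_le_left _ _, by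
        have := min_le_right (1 / 2) ((c - a) / 10)
        linarith⟩
    have herr := ((tendsto_const_nhds (x := c - 5 * ρ)).sub (hL.const_mul (2 * c + 4 / ρ ^ 2))).sub
      (hlog.const_mul (4 / ρ ^ 2))
    simp only [mul_zero, sub_zero] at herr
    refine le_liminf_of_le (by isBoundedDefault) ?_
    filter_upwards [herr.eventually_const_lt hρa, hdR.eventually_ge_atTop (2 / ρ)] with k h1 h2
    have := PolyZeros.le_zeroMean (by linarith : 0 ≤ c) hρ0 hρ1 h2 (hP k)
    exact_mod_cast h1.le.trans this
  exact ⟨hlim, le_trans (EReal.coe_le_coe_iff.mpr hc) hlim⟩
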